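/- Let $p$ be a prime, $k$ an algebraically closed field of characteristic $p$, and $K\supseteq k$ a perfect extension field. For a perfect field $L$ of characteristic $p$ let $W(L)$ be its ring of Witt vectors and $\sigma$ the Frobenius of $W(L)$ and of $\mathrm{Quot}(W(L))$. Let $N$ be an isocrystal over $k$, i.e. a finite-dimensional $\mathrm{Quot}(W(k))$-vector space with a $\sigma$-linear bijection $F:N\to N$, and put $V=pF^{-1}$. Assume that $N$ is simple (nonzero, and without $F$-stable subspaces other than $0$ and $N$) and bi-infinitesimal, i.e. $N$ contains a lattice $M$ (a finitely generated $W(k)$-submodule spanning $N$ over $\mathrm{Quot}(W(k))$) which is stable under $F$ and $V$ and on which $F$ and $V$ are topologically nilpotent ($F^nM\subseteq pM$ and $V^nM\subseteq pM$ for some $n$). Let $N_K=N\otimes_{\mathrm{Quot}(W(k))}\mathrm{Quot}(W(K))$ with the $\sigma$-linear extension $F\otimes\sigma$ of $F$ and with $V=pF^{-1}$; it is a left module over the Dieudonné ring $$\mathcal{D}(K)=W(K)[F,V]/(FV=VF=p,\ F\alpha=\alpha^{\sigma}F,\ \alpha V=V\alpha^{\sigma}\ \text{for}\ \alpha\in W(K)).$$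 Then for every $v\in N_K\setminus\{0\}$ the annihilator $\mathrm{Ann}(v)=\{A\in\mathcal{D}(K)\mid Av=0\}$ is a principal left ideal of $\mathcal{D}(K)$. -/

import Mathlib

noncomputable section

open scoped TensorProduct Isocrystal

namespace Dieudonne

/-! ### The Dieudonné ring -/

section Ring

variable (p : ℕ) [Fact p.Prime] (R : Type*) [CommRing R]

/-- Generators of the Dieudonné ring: the Witt vectors over `R`, and the two symbols `F`, `V`. -/
inductive Gen : Type _
  | coeff (a : WittVector p R) : Gen
  | F : Gen
  | V : Gen

open FreeAlgebra in
/-- Relations of the Dieudonné ring. The first four make `a ↦ coeff a` a ring homomorphism;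
the others are `F V = V F = p`, `F a = σ(a) F` and `a V = V σ(a)`. -/
inductive Rel : FreeAlgebra ℤ (Gen p R) → FreeAlgebra ℤ (Gen p R) → Prop
  | coeff_zero : Rel (ι ℤ (Gen.coeff 0)) 0
  | coeff_one : Rel (ι ℤ (Gen.coeff 1)) 1
  | coeff_add (a b : WittVector p R) :
      Rel (ι ℤ (Gen.coeff (a + b))) (ι ℤ (Gen.coeff a) + ι ℤ (Gen.coeff b))
  | coeff_mul (a b : WittVector p R) :
      Rel (ι ℤ (Gen.coeff (a * b))) (ι ℤ (Gen.coeff a) * ι ℤ (Gen.coeff b))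
  | F_mul_V : Rel (ι ℤ Gen.F * ι ℤ Gen.V) (p : FreeAlgebra ℤ (Gen p R))
  | V_mul_F : Rel (ι ℤ Gen.V * ι ℤ Gen.F) (p : FreeAlgebra ℤ (Gen p R))
  | F_mul_coeff (a : WittVector p R) :
      Rel (ι ℤ Gen.F * ι ℤ (Gen.coeff a))
        (ι ℤ (Gen.coeff (WittVector.frobenius a)) * ι ℤ Gen.F)
  | coeff_mul_V (a : WittVector p R) :
      Rel (ι ℤ (Gen.coeff a) * ι ℤ Gen.V)
        (ι ℤ Gen.V * ι ℤ (Gen.coeff (WittVector.frobenius a)))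

end Ring

end Dieudonne

/-- The Dieudonné ring
`𝒟(R) = W(R)[F, V] / (F V = V F = p, F a = σ(a) F, a V = V σ(a))`. -/
def DieudonneRing (p : ℕ) [Fact p.Prime] (R : Type*) [CommRing R] : Type _ :=
  RingQuot (Dieudonne.Rel p R)

instance DieudonneRing.instRing (p : ℕ) [Fact p.Prime] (R : Type*) [CommRing R] :
    Ring (DieudonneRing p R) :=
  inferInstanceAs (Ring (RingQuot (Dieudonne.Rel p R)))

namespace Dieudonne

variable (p : ℕ) [Fact p.Prime]

/-! ### Isocrystals -/

section Isocrystal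

variable (k : Type*) [Field k] [CharP k p] [PerfectRing k p]
variable (N : Type*) [AddCommGroup N] [WittVector.Isocrystal p k N]

/-- The Frobenius `F` of an isocrystal, as an additive bijection. -/
def frob : N ≃+ N := (Φ(p, k) : N ≃ᶠˡ[p, k] N).toAddEquiv

theorem frob_smul (c : K(p, k)) (x : N) :
    frob p k N (c • x) = WittVector.FractionRing.frobenius p k c • frob p k N x :=
  (Φ(p, k) : N ≃ᶠˡ[p, k] N).map_smul' c x

theorem frob_symm_smul (c : K(p, k)) (x : N) :
    (frob p k N).symm (WittVector.FractionRing.frobenius p k c • x) =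
      c • (frob p k N).symm x := by
  rw [AddEquiv.symm_apply_eq, frob_smul, AddEquiv.apply_symm_apply]

/-- The Verschiebung `V = p F⁻¹` of an isocrystal. -/
def ver : N →+ N where
  toFun x := (p : K(p, k)) • (frob p k N).symm x
  map_zero' := by simp
  map_add' x y := by simp

/-- An isocrystal is simple if it is nonzero and has no `F`-stable subspaces other than `0` and
itself. -/
structure IsSimpleIsocrystal : Prop where
  nontrivial : Nontrivial N
  eq_bot_or_eq_top : ∀ S : Submodule K(p, k) N, (∀ x ∈ S, frob p k N x ∈ S) → S = ⊥ ∨ S = ⊤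

/-- An isocrystal, regarded as a `W(k)`-module. -/
abbrev wittModule : Module (WittVector p k) N :=
  Module.compHom N (algebraMap (WittVector p k) K(p, k))

attribute [local instance] wittModule

/-- A Dieudonné lattice in an isocrystal: a finitely generated `W(k)`-submodule which spans it
over the fraction field of `W(k)` and is stable under `F` and `V`. -/
structure IsDieudonneLattice (M : Submodule (WittVector p k) N) : Prop where
  fg : M.FG
  span_eq_top : Submodule.span K(p, k) (M : Set N) = ⊤
  frob_mem : ∀ x ∈ M, frob p k N x ∈ M
  ver_mem : ∀ x ∈ M, ver p k N x ∈ M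

/-- An isocrystal is bi-infinitesimal if it is the rational Dieudonné module of a
bi-infinitesimal `p`-divisible group, that is, if it contains a Dieudonné lattice `M` on which
both `F` and `V` are topologically nilpotent: some power of each of them maps `M` into `p M`. -/
def IsBiInfinitesimal : Prop :=
  ∃ M : Submodule (WittVector p k) N, IsDieudonneLattice p k N M ∧
    (∃ n : ℕ, ∀ x ∈ M, ∃ y ∈ M, (frob p k N)^[n] x = p • y) ∧
    (∃ n : ℕ, ∀ x ∈ M, ∃ y ∈ M, (ver p k N)^[n] x = p • y)

/-! ### The action of the Dieudonné ring on an isocrystal -/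

/-- The action of the generators of the Dieudonné ring on an isocrystal: Witt vectors act by
scalar multiplication, `F` by the Frobenius and `V` by `p F⁻¹`. -/
def genAction : Gen p k → AddMonoid.End N
  | .coeff a => Module.toAddMonoidEnd K(p, k) N (algebraMap (WittVector p k) K(p, k) a)
  | .F => (frob p k N).toAddMonoidHom
  | .V => ver p k N

theorem frobenius_algebraMap (a : WittVector p k) :
    WittVector.FractionRing.frobenius p k (algebraMap (WittVector p k) K(p, k) a) =
      algebraMap (WittVector p k) K(p, k) (WittVector.frobenius a) :=
  IsFractionRing.ringEquivOfRingEquiv_algebraMap (WittVector.frobeniusEquiv p k) a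

theorem genAction_rel {x y : FreeAlgebra ℤ (Gen p k)} (h : Rel p k x y) :
    FreeAlgebra.lift ℤ (genAction p k N) x = FreeAlgebra.lift ℤ (genAction p k N) y := by
  refine AddMonoidHom.ext fun z ↦ ?_
  cases h with
  | coeff_zero => simp [genAction]
  | coeff_one => simp [genAction]
  | coeff_add a b => simp [genAction]
  | coeff_mul a b => simp [genAction]
  | F_mul_V =>
    rw [map_mul, FreeAlgebra.lift_ι_apply, FreeAlgebra.lift_ι_apply, map_natCast]
    change frob p k N ((p : K(p, k)) • (frob p k N).symm z) = p • z
    rw [frob_smul, map_natCast, AddEquiv.apply_symm_apply, Nat.cast_smul_eq_nsmul]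
  | V_mul_F =>
    rw [map_mul, FreeAlgebra.lift_ι_apply, FreeAlgebra.lift_ι_apply, map_natCast]
    change (p : K(p, k)) • (frob p k N).symm (frob p k N z) = p • z
    rw [AddEquiv.symm_apply_apply, Nat.cast_smul_eq_nsmul]
  | F_mul_coeff a =>
    simp only [map_mul, FreeAlgebra.lift_ι_apply]
    change frob p k N (algebraMap (WittVector p k) K(p, k) a • z) =
      algebraMap (WittVector p k) K(p, k) (WittVector.frobenius a) • frob p k N z
    rw [frob_smul, frobenius_algebraMap]
  | coeff_mul_V a =>
    simp only [map_mul, FreeAlgebra.lift_ι_apply]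
    change algebraMap (WittVector p k) K(p, k) a • (p : K(p, k)) • (frob p k N).symm z =
      (p : K(p, k)) • (frob p k N).symm
        (algebraMap (WittVector p k) K(p, k) (WittVector.frobenius a) • z)
    rw [← frobenius_algebraMap, frob_symm_smul, smul_comm]

/-- The action of the Dieudonné ring `𝒟(k)` on an isocrystal over `k`, as a ring
homomorphism. -/
def actionHom : DieudonneRing p k →+* AddMonoid.End N :=
  RingQuot.lift ⟨(FreeAlgebra.lift ℤ (genAction p k N)).toRingHom,
    fun _ _ h ↦ genAction_rel p k N h⟩

/-- An isocrystal over `k` is a left module over the Dieudonné ring `𝒟(k)`. -/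
instance instModule : Module (DieudonneRing p k) N := Module.compHom N (actionHom p k N)

end Isocrystal

/-! ### Base change of isocrystals -/

section BaseChange

variable (k : Type*) [Field k] [CharP k p] [PerfectRing k p]
variable (K : Type*) [Field K] [CharP K p] [PerfectRing K p] [Algebra k K]
variable (N : Type*) [AddCommGroup N] [WittVector.Isocrystal p k N]

/-- The map `Quot(W(k)) → Quot(W(K))` induced by a field extension `K` of `k`. -/
def fracMap : K(p, k) →+* K(p, K) :=
  IsFractionRing.map (j := WittVector.map (p := p) (algebraMap k K))
    (WittVector.map_injective _ (algebraMap k K).injective)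

theorem frobenius_fracMap (c : K(p, k)) :
    WittVector.FractionRing.frobenius p K (fracMap p k K c) =
      fracMap p k K (WittVector.FractionRing.frobenius p k c) := by
  have key (a : WittVector p k) : fracMap p k K (algebraMap _ _ a) =
      algebraMap _ _ (WittVector.map (algebraMap k K) a) := by
    simp [fracMap, IsFractionRing.map]
  obtain ⟨a, b, hb, rfl⟩ := IsFractionRing.div_surjective (A := WittVector p k) c
  have comm (a : WittVector p k) : WittVector.frobenius (WittVector.map (algebraMap k K) a) =
      WittVector.map (algebraMap k K) (WittVector.frobenius a) := by
    ext n
    simp [WittVector.coeff_frobenius_charP]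
  simp only [map_div₀, key, frobenius_algebraMap, comm]

/-- `Quot(W(K))` as an algebra over `Quot(W(k))`. -/
abbrev fracAlgebra : Algebra K(p, k) K(p, K) := (fracMap p k K).toAlgebra

attribute [local instance] fracAlgebra

/-- The base change `N_K = Quot(W(K)) ⊗ N` of an isocrystal `N` over `k` to `K`, the tensor
product being over `Quot(W(k))`. -/
def BaseChange : Type _ := K(p, K) ⊗[K(p, k)] N

instance : AddCommGroup (BaseChange p k K N) :=
  inferInstanceAs (AddCommGroup (K(p, K) ⊗[K(p, k)] N))

instance : Module K(p, K) (BaseChange p k K N) :=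
  inferInstanceAs (Module K(p, K) (K(p, K) ⊗[K(p, k)] N))

/-- The additive map `a ⊗ x ↦ f(a) ⊗ g(x)`, for maps `f` and `g` which are semilinear with
respect to the same `τ`. -/
def semilinearTensor (τ : K(p, k) → K(p, k)) (f : K(p, K) →+ K(p, K)) (g : N →+ N)
    (hf : ∀ c a, f (fracMap p k K c * a) = fracMap p k K (τ c) * f a)
    (hg : ∀ c x, g (c • x) = τ c • g x) :
    K(p, K) ⊗[K(p, k)] N →+ K(p, K) ⊗[K(p, k)] N :=
  TensorProduct.liftAddHom
    (AddMonoidHom.mk' (fun a ↦ AddMonoidHom.mk' (fun x ↦ f a ⊗ₜ[K(p, k)] g x)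
        (fun x y ↦ by rw [map_add, TensorProduct.tmul_add]))
      (fun a b ↦ by ext x; simp [TensorProduct.add_tmul]))
    (fun c a x ↦ by
      simp only [AddMonoidHom.mk'_apply, Algebra.smul_def, RingHom.algebraMap_toAlgebra, hf, hg]
      rw [← TensorProduct.smul_tmul, Algebra.smul_def, RingHom.algebraMap_toAlgebra])

theorem tensorHom_ext {f g : K(p, K) ⊗[K(p, k)] N →+ K(p, K) ⊗[K(p, k)] N}
    (h : ∀ a x, f (a ⊗ₜ x) = g (a ⊗ₜ x)) : f = g := by
  ext z
  induction z with
  | zero => simp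
  | add x y hx hy => simp only [map_add, hx, hy]
  | tmul a x => exact h a x

/-- The Frobenius `σ ⊗ F` of the base change. -/
def baseChangeFrob : K(p, K) ⊗[K(p, k)] N ≃+ K(p, K) ⊗[K(p, k)] N :=
  AddMonoidHom.toAddEquiv
    (semilinearTensor p k K N (WittVector.FractionRing.frobenius p k)
      (WittVector.FractionRing.frobenius p K).toAddEquiv.toAddMonoidHom
      (frob p k N).toAddMonoidHom
      (fun c a ↦ by
        simp [frobenius_fracMap])
      (fun c x ↦ frob_smul p k N c x))
    (semilinearTensor p k K N (WittVector.FractionRing.frobenius p k).symm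
      (WittVector.FractionRing.frobenius p K).symm.toAddEquiv.toAddMonoidHom
      (frob p k N).symm.toAddMonoidHom
      (fun c a ↦ (WittVector.FractionRing.frobenius p K).symm_apply_eq.2 (by
        rw [map_mul, frobenius_fracMap, RingEquiv.apply_symm_apply]
        exact congrArg _ ((WittVector.FractionRing.frobenius p K).apply_symm_apply a).symm))
      (fun c x ↦ (frob p k N).symm_apply_eq.2 (by
        rw [frob_smul, RingEquiv.apply_symm_apply]
        exact congrArg _ ((frob p k N).apply_symm_apply x).symm)))
    (tensorHom_ext p k K N fun a x ↦ congrArg₂ (· ⊗ₜ[K(p, k)] ·)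
      ((WittVector.FractionRing.frobenius p K).symm_apply_apply a)
      ((frob p k N).symm_apply_apply x))
    (tensorHom_ext p k K N fun a x ↦ congrArg₂ (· ⊗ₜ[K(p, k)] ·)
      ((WittVector.FractionRing.frobenius p K).apply_symm_apply a)
      ((frob p k N).apply_symm_apply x))

theorem baseChangeFrob_tmul (a : K(p, K)) (x : N) :
    baseChangeFrob p k K N (a ⊗ₜ[K(p, k)] x) =
      WittVector.FractionRing.frobenius p K a ⊗ₜ[K(p, k)] frob p k N x := rfl

theorem baseChangeFrob_smul (c : K(p, K)) (x : K(p, K) ⊗[K(p, k)] N) :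
    baseChangeFrob p k K N (c • x) =
      WittVector.FractionRing.frobenius p K c • baseChangeFrob p k K N x := by
  induction x with
  | zero => simp
  | add x y hx hy => simp only [smul_add, map_add, hx, hy]
  | tmul a x =>
    simp only [TensorProduct.smul_tmul', smul_eq_mul, baseChangeFrob_tmul, map_mul]

/-- The base change of an isocrystal over `k` is an isocrystal over `K`, with `F = σ ⊗ F`. -/
instance baseChangeIsocrystal : WittVector.Isocrystal p K (BaseChange p k K N) where
  frob :=
    { baseChangeFrob p k K N with
      map_smul' := baseChangeFrob_smul p k K N }

/-- The Frobenius of the base change is `a ⊗ x ↦ σ(a) ⊗ F(x)`. -/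
theorem frob_baseChange_tmul (a : K(p, K)) (x : N) :
    frob p K (BaseChange p k K N) (a ⊗ₜ[K(p, k)] x : K(p, K) ⊗[K(p, k)] N) =
      (WittVector.FractionRing.frobenius p K a ⊗ₜ[K(p, k)] frob p k N x :
        K(p, K) ⊗[K(p, k)] N) := rfl

end BaseChange
end Dieudonne
end

noncomputable section

open scoped TensorProduct Isocrystal

open Finset

/-! Multiplying v by a power of p does not change Ann(v) (`torsionOf_natCast_smul`), so v may be
taken in the W(K)-lattice generated by M. Let P be the W(K)-span of all F^n v and V^n v. It is
finitely generated, and by Artin–Rees F and V stay topologically nilpotent on it. Modulo VP the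
module P is generated by powers F^i v, modulo FP by powers V^j v. Let c+1 and d+1 be the least
exponents with F^(c+1) v ∈ VP and V^(d+1) v ∈ FP. Then the "box" V^j v (0 ≤ j ≤ d), F^i v (1 ≤ i ≤
c+1) is a basis of P, by Nakayama and the filtration P ⊇ FP ⊇ FVP = pP.

Expanding V^(d+1) v in this basis gives A = V^(d+1) - Σ a_j V^j - Σ b_i F^(i+1) in Ann(v), and
minimality of d makes the last coefficient b_c a unit (`exists_relation`). Hence A can be solved for
V^(d+1) and FA for F^(c+2), so that 𝒟(K) is the W(K)-span of the box plus 𝒟(K)A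
(`boxSpan_sup_stable`). If B kills v, so does its box part, which then vanishes by independence.
Thus Ann(v) = 𝒟(K)A. -/

/-- A Frobenius–Verschiebung pair: additive endomorphisms `F`, `V` of an `R`-module which are
semilinear with respect to `σ` and `σ⁻¹` and satisfy `F V = V F = π`. -/
structure FVPair {R X : Type*} [CommRing R] [AddCommGroup X] [Module R X]
    (σ : R ≃+* R) (π : R) (F V : X →+ X) : Prop where
  F_smul : ∀ a x, F (a • x) = σ a • F x
  V_smul : ∀ a x, V (a • x) = σ.symm a • V x
  F_V : ∀ x, F (V x) = π • x
  V_F : ∀ x, V (F x) = π • x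

namespace FVPair

/-! ### Frobenius–Verschiebung pairs over a commutative ring -/

section General

variable {R X : Type*} [CommRing R] [AddCommGroup X] [Module R X]
  {σ : R ≃+* R} {π : R} {F V : X →+ X}

/-- Every statement about F yields its mirror for V; in particular `h.symm.map S` below is the image
V S. -/
theorem symm (h : FVPair σ π F V) : FVPair σ.symm π V F :=
  ⟨h.V_smul, h.F_smul, h.V_F, h.F_V⟩

theorem commute (h : FVPair σ π F V) : Function.Commute (F : X → X) V :=
  fun x ↦ (h.F_V x).trans (h.V_F x).symm

/-- Both sides equal F V F x, so σ π = π need not be assumed. -/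
theorem F_smul_uniformizer (h : FVPair σ π F V) (x : X) : F (π • x) = π • F x := by
  rw [← h.V_F, h.F_V]

theorem iterate_smul_pow (h : FVPair σ π F V) (n s : ℕ) (x : X) :
    F^[n] (π ^ s • x) = π ^ s • F^[n] x := by
  have h1 (y : X) : F (π ^ s • y) = π ^ s • F y := by
    induction s generalizing y with
    | zero => simp
    | succ s ih => rw [pow_succ, mul_smul, mul_smul, ih, h.F_smul_uniformizer]
  induction n generalizing x with
  | zero => rfl
  | succ n ih => rw [Function.iterate_succ_apply, h1, ih, Function.iterate_succ_apply]

theorem F_injective (h : FVPair σ π F V) (hπ : ∀ x : X, π • x = 0 → x = 0) :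
    Function.Injective F :=
  (injective_iff_map_eq_zero F).2 fun x hx ↦ hπ x (by rw [← h.V_F, hx, map_zero])

/-- The image of a submodule under `F`. -/
def map (h : FVPair σ π F V) (S : Submodule R X) : Submodule R X where
  carrier := F '' S
  zero_mem' := ⟨0, S.zero_mem, map_zero F⟩
  add_mem' := by
    rintro _ _ ⟨x, hx, rfl⟩ ⟨y, hy, rfl⟩
    exact ⟨x + y, S.add_mem hx hy, map_add F x y⟩
  smul_mem' := by
    rintro a _ ⟨x, hx, rfl⟩
    exact ⟨σ.symm a • x, S.smul_mem _ hx, by rw [h.F_smul, σ.apply_symm_apply]⟩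

/-- The preimage of a submodule under `F`. -/
def comap (h : FVPair σ π F V) (S : Submodule R X) : Submodule R X where
  carrier := F ⁻¹' S
  zero_mem' := by simp
  add_mem' hx hy := by simpa using S.add_mem hx hy
  smul_mem' a x hx := by simpa [h.F_smul] using S.smul_mem (σ a) hx

theorem mem_comap (h : FVPair σ π F V) {S : Submodule R X} {x : X} :
    x ∈ h.comap S ↔ F x ∈ S := Iff.rfl

theorem mem_iterate_comap (h : FVPair σ π F V) {S : Submodule R X} {x : X} (n : ℕ) :
    x ∈ h.comap^[n] S ↔ F^[n] x ∈ S := by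
  induction n generalizing x with
  | zero => rfl
  | succ n ih => rw [Function.iterate_succ_apply', mem_comap, ih, Function.iterate_succ_apply]

theorem iterate_mem {S : Submodule R X} (hS : ∀ x ∈ S, F x ∈ S) (n : ℕ) {x : X} (hx : x ∈ S) :
    F^[n] x ∈ S := by
  induction n with
  | zero => exact hx
  | succ n ih => rw [Function.iterate_succ_apply']; exact hS _ ih

/-- The smallest submodule containing `v` and stable under `F` and `V`. -/
def orbitSpan (R : Type*) {X : Type*} [CommRing R] [AddCommGroup X] [Module R X]
    (F V : X →+ X) (v : X) : Submodule R X :=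
  Submodule.span R (Set.range (fun n ↦ F^[n] v) ∪ Set.range (fun n ↦ V^[n] v))

theorem orbitSpan_comm (F V : X →+ X) (v : X) : orbitSpan R F V v = orbitSpan R V F v := by
  rw [orbitSpan, Set.union_comm, orbitSpan]

theorem iterate_mem_orbitSpan (F V : X →+ X) (v : X) (n : ℕ) : F^[n] v ∈ orbitSpan R F V v :=
  Submodule.subset_span (Or.inl ⟨n, rfl⟩)

theorem self_mem_orbitSpan (F V : X →+ X) (v : X) : v ∈ orbitSpan R F V v :=
  iterate_mem_orbitSpan F V v 0

/-- Mixed words in F and V contract through F V = π, so pure powers of F and V already span a stable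
module. -/
theorem F_mem_orbitSpan (h : FVPair σ π F V) (v : X) :
    ∀ x ∈ orbitSpan R F V v, F x ∈ orbitSpan R F V v := by
  change orbitSpan R F V v ≤ h.comap (orbitSpan R F V v)
  refine Submodule.span_le.2 ?_
  rintro _ (⟨n, rfl⟩ | ⟨n, rfl⟩)
  · rw [SetLike.mem_coe, mem_comap, ← Function.iterate_succ_apply' (f := F)]
    exact iterate_mem_orbitSpan F V v _
  · cases n with
    | zero => exact iterate_mem_orbitSpan F V v 1
    | succ n =>
      rw [SetLike.mem_coe, mem_comap]
      beta_reduce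
      rw [Function.iterate_succ_apply', h.F_V, orbitSpan_comm]
      exact Submodule.smul_mem _ _ (iterate_mem_orbitSpan V F v n)

theorem V_mem_orbitSpan (h : FVPair σ π F V) (v : X) :
    ∀ x ∈ orbitSpan R F V v, V x ∈ orbitSpan R F V v := by
  rw [orbitSpan_comm]
  exact h.symm.F_mem_orbitSpan v

theorem orbitSpan_le {M : Submodule R X} (hF : ∀ x ∈ M, F x ∈ M) (hV : ∀ x ∈ M, V x ∈ M)
    {v : X} (hv : v ∈ M) : orbitSpan R F V v ≤ M := by
  refine Submodule.span_le.2 ?_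
  rintro _ (⟨n, rfl⟩ | ⟨n, rfl⟩)
  · exact iterate_mem hF n hv
  · exact iterate_mem hV n hv

theorem smul_mem_map (h : FVPair σ π F V) {S : Submodule R X} (hV : ∀ x ∈ S, V x ∈ S) {x : X}
    (hx : x ∈ S) : π • x ∈ h.map S :=
  ⟨V x, hV x hx, h.F_V x⟩

/-- The span of `V^j e` for `j < d` and `F^(i+1) e` for `i < c`. -/
def boxSpan (R : Type*) {X : Type*} [CommRing R] [AddCommGroup X] [Module R X]
    (F V : X →+ X) (e : X) (c d : ℕ) : Submodule R X :=
  Submodule.span R ((fun j ↦ V^[j] e) '' (range d : Set ℕ)) ⊔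
    Submodule.span R ((fun i ↦ F^[i + 1] e) '' (range c : Set ℕ))

theorem mem_boxSpan {e x : X} {c d : ℕ} : x ∈ boxSpan R F V e c d ↔
    ∃ a b : ℕ → R,
      ∑ j ∈ range d, a j • V^[j] e + ∑ i ∈ range c, b i • F^[i + 1] e = x := by
  simp only [boxSpan, Submodule.mem_sup, Submodule.mem_span_image_finset_iff_exists_fun']
  constructor
  · rintro ⟨_, ⟨a, rfl⟩, _, ⟨b, rfl⟩, rfl⟩
    exact ⟨a, b, rfl⟩
  · rintro ⟨a, b, rfl⟩
    exact ⟨_, ⟨a, rfl⟩, _, ⟨b, rfl⟩, rfl⟩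

theorem V_iterate_mem_boxSpan {e : X} {c d j : ℕ} (hj : j < d) :
    V^[j] e ∈ boxSpan R F V e c d :=
  Submodule.mem_sup_left (Submodule.subset_span ⟨j, by simpa using hj, rfl⟩)

theorem F_iterate_mem_boxSpan {e : X} {c d i : ℕ} (hi : i < c) :
    F^[i + 1] e ∈ boxSpan R F V e c d :=
  Submodule.mem_sup_right (Submodule.subset_span ⟨i, by simpa using hi, rfl⟩)

theorem boxSpan_le {e : X} {c d : ℕ} {S : Submodule R X} (hV : ∀ j < d, V^[j] e ∈ S)
    (hF : ∀ i < c, F^[i + 1] e ∈ S) : boxSpan R F V e c d ≤ S := by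
  refine sup_le (Submodule.span_le.2 ?_) (Submodule.span_le.2 ?_)
  · rintro _ ⟨j, hj, rfl⟩
    exact hV j (by simpa using hj)
  · rintro _ ⟨i, hi, rfl⟩
    exact hF i (by simpa using hi)

/-- A relation expressing `V^(d+1) e` modulo a stable submodule `Q` through a box, with a unit
coefficient at the last power of `F`, makes the box stable modulo `Q`. -/
theorem boxSpan_sup_stable (h : FVPair σ π F V) {Q : Submodule R X}
    (hQF : ∀ x ∈ Q, F x ∈ Q) (hQV : ∀ x ∈ Q, V x ∈ Q) {e : X} {c d : ℕ} {a b : ℕ → R}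
    (hb : IsUnit (b c))
    (hA : V^[d + 1] e - (∑ j ∈ range (d + 1), a j • V^[j] e +
      ∑ i ∈ range (c + 1), b i • F^[i + 1] e) ∈ Q) :
    (∀ x ∈ boxSpan R F V e (c + 1) (d + 1) ⊔ Q, F x ∈ boxSpan R F V e (c + 1) (d + 1) ⊔ Q) ∧
    (∀ x ∈ boxSpan R F V e (c + 1) (d + 1) ⊔ Q, V x ∈ boxSpan R F V e (c + 1) (d + 1) ⊔ Q) := by
  set S := boxSpan R F V e (c + 1) (d + 1) ⊔ Q with hS
  have hVS {j : ℕ} (hj : j < d + 1) : V^[j] e ∈ S :=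
    Submodule.mem_sup_left (V_iterate_mem_boxSpan hj)
  have hFS {i : ℕ} (hi : i < c + 1) : F^[i + 1] e ∈ S :=
    Submodule.mem_sup_left (F_iterate_mem_boxSpan hi)
  have hFS' {i : ℕ} (hi : i < c + 1) : F^[i] e ∈ S := by
    cases i with
    | zero => exact hVS (Nat.succ_pos d)
    | succ i => exact hFS (by omega)
  have hFV {j : ℕ} (hj : j < d + 1) : F (V^[j] e) ∈ S := by
    cases j with
    | zero => exact hFS (Nat.succ_pos c)
    | succ j =>
      rw [Function.iterate_succ_apply', h.F_V]
      exact S.smul_mem _ (hVS (by omega))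
  have hFA := hQF _ hA
  have hVtop : V^[d + 1] e ∈ S := by
    rw [← sub_add_cancel (V^[d + 1] e) (∑ j ∈ range (d + 1), a j • V^[j] e +
      ∑ i ∈ range (c + 1), b i • F^[i + 1] e)]
    exact S.add_mem (Submodule.mem_sup_right hA)
      (Submodule.mem_sup_left (mem_boxSpan.2 ⟨a, b, rfl⟩))
  -- Applying F to the relation turns V^(d+1) e into π V^d e, which lies in the box. The only term
  -- not yet known to lie in S is σ(b_c) F^(c+2) e, and its coefficient is a unit.
  have hFtop : F (F^[c + 1] e) ∈ S := by
    have hbc : IsUnit (σ (b c)) := hb.map σ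
    rw [← Submodule.smul_mem_iff_of_isUnit S hbc]
    have e1 : σ (b c) • F (F^[c + 1] e) = F (V^[d + 1] e) -
        (∑ j ∈ range (d + 1), σ (a j) • F (V^[j] e) +
          ∑ i ∈ range c, σ (b i) • F (F^[i + 1] e)) -
        F (V^[d + 1] e - (∑ j ∈ range (d + 1), a j • V^[j] e +
          ∑ i ∈ range (c + 1), b i • F^[i + 1] e)) := by
      simp only [map_sub, map_add, map_sum, h.F_smul, sum_range_succ _ c]
      abel
    rw [e1]
    refine S.sub_mem (S.sub_mem ?_ (S.add_mem ?_ ?_)) (Submodule.mem_sup_right hFA)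
    · rw [Function.iterate_succ_apply', h.F_V]
      exact S.smul_mem _ (hVS (Nat.lt_succ_self d))
    · exact S.sum_mem fun j hj ↦ S.smul_mem _ (hFV (mem_range.1 hj))
    · refine S.sum_mem fun i hi ↦ S.smul_mem _ ?_
      rw [← Function.iterate_succ_apply' (f := F)]
      exact hFS (Nat.succ_lt_succ (mem_range.1 hi))
  constructor
  · change S ≤ h.comap S
    refine sup_le (boxSpan_le (fun j hj ↦ hFV hj) fun i hi ↦ ?_)
      fun x hx ↦ Submodule.mem_sup_right (hQF x hx)
    rcases Nat.lt_succ_iff_lt_or_eq.1 hi with hi | rfl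
    · rw [mem_comap, ← Function.iterate_succ_apply' (f := F)]
      exact hFS (by omega)
    · exact hFtop
  · change S ≤ h.symm.comap S
    refine sup_le (boxSpan_le (fun j hj ↦ ?_) fun i hi ↦ ?_)
      fun x hx ↦ Submodule.mem_sup_right (hQV x hx)
    · rw [mem_comap, ← Function.iterate_succ_apply' (f := V)]
      rcases Nat.lt_succ_iff_lt_or_eq.1 hj with hj | rfl
      · exact hVS (by omega)
      · exact hVtop
    · rw [mem_comap, Function.iterate_succ_apply', h.V_F]
      exact S.smul_mem _ (hFS' hi)

theorem iterate_mul_eq_pow_smul (h : FVPair σ π F V) {M : Submodule R X} {n : ℕ}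
    (hn : ∀ x ∈ M, ∃ y ∈ M, F^[n] x = π • y) (s : ℕ) :
    ∀ x ∈ M, ∃ y ∈ M, F^[n * s] x = π ^ s • y := by
  induction s with
  | zero => exact fun x hx ↦ ⟨x, hx, by simp⟩
  | succ s ih =>
    intro x hx
    obtain ⟨y, hy, hxy⟩ := ih x hx
    obtain ⟨z, hz, hyz⟩ := hn y hy
    refine ⟨z, hz, ?_⟩
    rw [mul_add, mul_one, add_comm, Function.iterate_add_apply, hxy, h.iterate_smul_pow, hyz,
      smul_smul, pow_succ]

/-- Artin–Rees for the ideal (π) and P ∩ M ⊆ M: for large k the intersection π^(k+1) M ∩ P equals π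
(π^k M ∩ P), which lies in π P. -/
theorem exists_pow_smul_mem_imp [IsNoetherianRing R] (π : R) {M P : Submodule R X} (hM : M.FG) :
    ∃ k, ∀ x ∈ M, π ^ k • x ∈ P → ∃ y ∈ P, π ^ k • x = π • y := by
  have : Module.Finite R M := Module.Finite.iff_fg.2 hM
  obtain ⟨k, hk⟩ := Ideal.exists_pow_inf_eq_pow_smul (Ideal.span {π}) (P.comap M.subtype)
  refine ⟨k + 1, fun x hx hxP ↦ ?_⟩
  have h1 : π ^ (k + 1) • (⟨x, hx⟩ : M) ∈
      Ideal.span {π} ^ (k + 1) • (⊤ : Submodule R M) ⊓ P.comap M.subtype :=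
    ⟨Submodule.smul_mem_smul (Ideal.pow_mem_pow (Ideal.mem_span_singleton_self π) _) trivial,
      hxP⟩
  rw [hk _ (Nat.le_succ k), show k.succ - k = 1 by simp, pow_one,
    Submodule.ideal_span_singleton_smul, Submodule.mem_smul_pointwise_iff_exists] at h1
  obtain ⟨y, hy, hyx⟩ := h1
  exact ⟨y, hy.2, congrArg Subtype.val hyx.symm⟩

/-- Topological nilpotence descends to stable submodules: with k from Artin–Rees, F^(nk) maps P into
π^k M ∩ P ⊆ π P. -/
theorem exists_iterate_eq_smul_of_le [IsNoetherianRing R] (h : FVPair σ π F V)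
    {M P : Submodule R X} (hM : M.FG) (hPM : P ≤ M) (hPF : ∀ x ∈ P, F x ∈ P)
    (hn : ∃ n : ℕ, ∀ x ∈ M, ∃ y ∈ M, F^[n] x = π • y) :
    ∃ n : ℕ, ∀ x ∈ P, ∃ y ∈ P, F^[n] x = π • y := by
  obtain ⟨n, hn⟩ := hn
  obtain ⟨k, hk⟩ := exists_pow_smul_mem_imp π (P := P) hM
  refine ⟨n * k, fun x hx ↦ ?_⟩
  obtain ⟨y, hy, hxy⟩ := h.iterate_mul_eq_pow_smul hn k x (hPM hx)
  rw [hxy]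
  exact hk y hy (hxy ▸ iterate_mem hPF _ hx)

/-- Modulo `V P`, the module `P` is spanned by the first powers `F^i v`. -/
theorem exists_sum_add_V (h : FVPair σ π F V) {v : X} {c : ℕ}
    (hc : F^[c] v ∈ h.symm.map (orbitSpan R F V v)) {x : X} (hx : x ∈ orbitSpan R F V v) :
    ∃ b : ℕ → R, ∃ y ∈ orbitSpan R F V v, x = ∑ i ∈ range c, b i • F^[i] v + V y := by
  set P := orbitSpan R F V v with hP
  have hPF := h.F_mem_orbitSpan v
  have hle : P ≤ Submodule.span R ((fun i ↦ F^[i] v) '' (range c : Set ℕ)) ⊔ h.symm.map P := by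
    have hF (n : ℕ) : F^[n] v ∈
        Submodule.span R ((fun i ↦ F^[i] v) '' (range c : Set ℕ)) ⊔ h.symm.map P := by
      rcases lt_or_ge n c with hn | hn
      · exact Submodule.mem_sup_left (Submodule.subset_span ⟨n, by simpa using hn, rfl⟩)
      -- If F^c v = V z, then F^n v = F^(n-c) V z = V F^(n-c) z for all n ≥ c.
      · obtain ⟨z, hz, hzc⟩ := hc
        refine Submodule.mem_sup_right ⟨F^[n - c] z, iterate_mem hPF _ hz, ?_⟩
        rw [← (h.commute.iterate_left (n - c)).eq, hzc, ← Function.iterate_add_apply,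
          Nat.sub_add_cancel hn]
    refine Submodule.span_le.2 ?_
    rintro _ (⟨n, rfl⟩ | ⟨n, rfl⟩)
    · exact hF n
    · cases n with
      | zero => exact hF 0
      | succ n =>
        refine Submodule.mem_sup_right ⟨V^[n] v, ?_, (Function.iterate_succ_apply' V n v).symm⟩
        rw [hP, orbitSpan_comm]
        exact iterate_mem_orbitSpan V F v n
  obtain ⟨y, hy, _, ⟨z, hz, rfl⟩, rfl⟩ := Submodule.mem_sup.1 (hle hx)
  obtain ⟨b, rfl⟩ := Submodule.mem_span_image_finset_iff_exists_fun' R |>.1 hy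
  exact ⟨b, z, hz, rfl⟩

/-- F(π v) is both σ(π) F v and π F v. The equality lets divisibility by π pass through σ. -/
theorem apply_uniformizer [IsDomain R] [Module.IsTorsionFree R X] (h : FVPair σ π F V)
    {v : X} (hv : v ≠ 0) (hinj : Function.Injective F) : σ π = π := by
  have h1 : (σ π - π) • F v = 0 := by
    rw [sub_smul, ← h.F_smul, h.F_smul_uniformizer, sub_self]
  refine sub_eq_zero.1 ((smul_eq_zero.1 h1).resolve_right fun h0 ↦ hv (hinj ?_))
  rw [h0, map_zero]

end General

/-! ### The box basis over a discrete valuation ring -/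

section Local

variable {R X : Type*} [CommRing R] [IsDomain R] [IsDiscreteValuationRing R]
  [AddCommGroup X] [Module R X] {σ : R ≃+* R} {π : R} {F V : X →+ X}

/-- Nakayama's lemma: P ⊆ Q + π P with P finitely generated. -/
theorem le_of_le_sup_smul (hπ : Irreducible π) {P Q : Submodule R X} (hP : P.FG)
    (hPQ : ∀ x ∈ P, ∃ y ∈ Q, ∃ z ∈ P, x = y + π • z) : P ≤ Q := by
  refine Submodule.le_of_le_smul_of_le_jacobson_bot (I := IsLocalRing.maximalIdeal R) hP
    (IsLocalRing.maximalIdeal_le_jacobson ⊥) fun x hx ↦ ?_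
  obtain ⟨y, hy, z, hz, rfl⟩ := hPQ x hx
  rw [hπ.maximalIdeal_eq]
  exact Submodule.add_mem_sup hy
    (Submodule.smul_mem_smul (Ideal.mem_span_singleton_self π) hz)

theorem isUnit_of_not_dvd (hπ : Irreducible π) {a : R} (ha : ¬ π ∣ a) : IsUnit a := by
  by_contra hu
  rw [← mem_nonunits_iff, ← IsLocalRing.mem_maximalIdeal, hπ.maximalIdeal_eq,
    Ideal.mem_span_singleton] at hu
  exact ha hu

/-- If every instance of `p` is divisible by `π` with quotient again an instance, then the
coefficients vanish. -/
theorem eq_zero_of_forall_dvd (hπ : Irreducible π) {ι : Type*} {s : Set ι} {P : (ι → R) → Prop}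
    (hP : ∀ a, P a → ∃ a', P a' ∧ ∀ i ∈ s, a i = π * a' i) {a : ι → R} (ha : P a) :
    ∀ i ∈ s, a i = 0 := by
  have key (n : ℕ) : ∀ a, P a → ∀ i ∈ s, π ^ n ∣ a i := by
    induction n with
    | zero => simp
    | succ n ih =>
      intro a ha i hi
      obtain ⟨a', ha', h⟩ := hP a ha
      rw [h i hi, pow_succ']
      exact mul_dvd_mul_left π (ih a' ha' i hi)
  intro i hi
  by_contra hne
  obtain ⟨n, u, hu⟩ := IsDiscreteValuationRing.eq_unit_mul_pow_irreducible hne hπ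
  have h1 := key (n + 1) a ha i hi
  rw [hu, Units.dvd_mul_left, pow_dvd_pow_iff hπ.ne_zero hπ.not_isUnit] at h1
  omega

/-- The powers `F^i v`, up to the first which lies in `V P`, are independent modulo `V P`. -/
theorem dvd_of_sum_mem_map (hπ : Irreducible π) (h : FVPair σ π F V) {v : X} {c : ℕ}
    (hc : F^[c] v ∈ h.symm.map (orbitSpan R F V v))
    (hmin : ∀ m < c, F^[m] v ∉ h.symm.map (orbitSpan R F V v)) {b : ℕ → R}
    (hb : ∑ i ∈ range c, b i • F^[i] v ∈ h.symm.map (orbitSpan R F V v)) :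
    ∀ i < c, π ∣ b i := by
  set P := orbitSpan R F V v with hP
  have hPF := h.F_mem_orbitSpan v
  have hstab : ∀ x ∈ h.symm.map P, F x ∈ h.symm.map P := by
    rintro _ ⟨y, hy, rfl⟩
    exact ⟨F y, hPF y hy, (h.commute y).symm⟩
  intro i
  induction i using Nat.strong_induction_on with
  | _ i ih =>
    intro hi
    by_contra hdvd
    -- Apply F^(c-1-i) to the sum. Terms with j < i have coefficient divisible by π, and π P ⊆ VP;
    -- terms with j > i reach exponent at least c. What remains is a unit times F^(c-1) v, which
    -- would lie in VP against minimality. Working in the preimage of VP hides the twists by σ.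
    have hmem : F^[i] v ∈ h.comap^[c - 1 - i] (h.symm.map P) := by
      rw [← Submodule.smul_mem_iff_of_isUnit _ (isUnit_of_not_dvd hπ hdvd),
        ← sub_eq_of_eq_add (add_sum_erase (range c) (fun i ↦ b i • F^[i] v)
          (mem_range.2 hi)).symm]
      refine Submodule.sub_mem _ ((h.mem_iterate_comap _).2 (iterate_mem hstab _ hb))
        (Submodule.sum_mem _ fun j hj ↦ ?_)
      obtain ⟨hji, hjc⟩ := mem_erase.1 hj
      rcases lt_or_gt_of_ne hji with hji | hji
      · obtain ⟨b', hb'⟩ := ih j hji (mem_range.1 hjc)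
        rw [hb', mul_smul]
        refine (h.mem_iterate_comap _).2 (iterate_mem hstab _ (h.symm.smul_mem_map hPF ?_))
        exact Submodule.smul_mem _ _ (iterate_mem_orbitSpan F V v j)
      · refine Submodule.smul_mem _ _ ((h.mem_iterate_comap _).2 ?_)
        rw [← Function.iterate_add_apply, show c - 1 - i + j = (j - 1 - i) + c by
          have := mem_range.1 hjc; omega, Function.iterate_add_apply]
        exact iterate_mem hstab _ hc
    rw [mem_iterate_comap, ← Function.iterate_add_apply] at hmem
    exact hmin _ (by omega) hmem

/-- A least exponent exists because F^n v ∈ π P ⊆ VP for some n. It is positive: otherwise P = VP,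
so P = V^n P ⊆ π P for a suitable n, and Nakayama gives P = 0. -/
theorem exists_minimal_power (hπ : Irreducible π) (h : FVPair σ π F V) {v : X} (hv : v ≠ 0)
    (hfg : (orbitSpan R F V v).FG)
    (hF : ∃ n : ℕ, ∀ x ∈ orbitSpan R F V v, ∃ y ∈ orbitSpan R F V v, F^[n] x = π • y)
    (hV : ∃ n : ℕ, ∀ x ∈ orbitSpan R F V v, ∃ y ∈ orbitSpan R F V v, V^[n] x = π • y) :
    ∃ c, F^[c + 1] v ∈ h.symm.map (orbitSpan R F V v) ∧
      ∀ m < c + 1, F^[m] v ∉ h.symm.map (orbitSpan R F V v) := by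
  classical
  set P := orbitSpan R F V v with hP
  have hPF := h.F_mem_orbitSpan v
  have hex : ∃ c, F^[c] v ∈ h.symm.map P := by
    obtain ⟨n, hn⟩ := hF
    obtain ⟨y, hy, hxy⟩ := hn v (self_mem_orbitSpan F V v)
    exact ⟨n, hxy ▸ h.symm.smul_mem_map hPF hy⟩
  obtain ⟨c, hc⟩ : ∃ c, Nat.find hex = c + 1 := by
    refine Nat.exists_eq_succ_of_ne_zero fun h0 ↦ hv ?_
    have hc := Nat.find_spec hex
    rw [h0] at hc
    have hpow (n : ℕ) : ∀ x ∈ P, ∃ y ∈ P, x = V^[n] y := by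
      induction n with
      | zero => exact fun x hx ↦ ⟨x, hx, rfl⟩
      | succ n ih =>
        intro x hx
        obtain ⟨y, hy, rfl⟩ := ih x hx
        obtain ⟨b, z, hz, rfl⟩ := h.exists_sum_add_V hc hy
        exact ⟨z, hz, by simp⟩
    obtain ⟨n, hn⟩ := hV
    have hbot : P ≤ ⊥ := le_of_le_sup_smul hπ hfg fun x hx ↦ by
      obtain ⟨y, hy, rfl⟩ := hpow n x hx
      obtain ⟨z, hz, hyz⟩ := hn y hy
      exact ⟨0, Submodule.zero_mem _, z, hz, by rw [hyz, zero_add]⟩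
    exact (Submodule.mem_bot R).1 (hbot (self_mem_orbitSpan F V v))
  exact ⟨c, hc ▸ Nat.find_spec hex, fun m hm ↦ Nat.find_min hex (hc ▸ hm)⟩

/-- The images of the V^j v in P/FP and of the F^(i+1) v in FP/πP are bases, so together they form a
basis of P. The relation for V^(d+1) v is its expansion in that basis. -/
theorem exists_relation [Module.IsTorsionFree R X] (hπ : Irreducible π) (h : FVPair σ π F V)
    {v : X} (hv : v ≠ 0) (hfg : (orbitSpan R F V v).FG)
    (hF : ∃ n : ℕ, ∀ x ∈ orbitSpan R F V v, ∃ y ∈ orbitSpan R F V v, F^[n] x = π • y)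
    (hV : ∃ n : ℕ, ∀ x ∈ orbitSpan R F V v, ∃ y ∈ orbitSpan R F V v, V^[n] x = π • y) :
    ∃ (c d : ℕ) (a b : ℕ → R), IsUnit (b c) ∧
      V^[d + 1] v = ∑ j ∈ range (d + 1), a j • V^[j] v +
        ∑ i ∈ range (c + 1), b i • F^[i + 1] v ∧
      ∀ a' b' : ℕ → R, ∑ j ∈ range (d + 1), a' j • V^[j] v +
        ∑ i ∈ range (c + 1), b' i • F^[i + 1] v = 0 →
        (∀ j < d + 1, a' j = 0) ∧ ∀ i < c + 1, b' i = 0 := by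
  have htf (x : X) (hx : π • x = 0) : x = 0 := (smul_eq_zero.1 hx).resolve_left hπ.ne_zero
  have hFinj := h.F_injective htf
  have hVinj := h.symm.F_injective htf
  have hσ : σ π = π := h.apply_uniformizer hv hFinj
  obtain ⟨c, hc, hcmin⟩ := exists_minimal_power hπ h hv hfg hF hV
  have hd' := exists_minimal_power hπ h.symm hv (orbitSpan_comm (R := R) F V v ▸ hfg)
    (orbitSpan_comm (R := R) F V v ▸ hV) (orbitSpan_comm (R := R) F V v ▸ hF)
  have hSV {d : ℕ} {b : ℕ → R} := dvd_of_sum_mem_map (b := b) hπ h.symm (v := v) (c := d)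
  have hspanV {d : ℕ} {x : X} :=
    exists_sum_add_V (R := R) h.symm (v := v) (c := d) (x := x)
  have hPV := h.V_mem_orbitSpan v
  have hPF := h.F_mem_orbitSpan v
  rw [← orbitSpan_comm F V v] at hd' hSV hspanV
  obtain ⟨d, hd, hdmin⟩ := hd'
  set P := orbitSpan R F V v with hP
  have hvP (n : ℕ) : F^[n] v ∈ P := iterate_mem_orbitSpan F V v n
  have hvP' (n : ℕ) : V^[n] v ∈ P := by
    rw [hP, orbitSpan_comm]; exact iterate_mem_orbitSpan V F v n
  -- Write x = Σ a_j V^j v + F y and then y = Σ b_i F^i v + V z; since F V = π, the error in x is π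
  -- z.
  have hle : P ≤ boxSpan R F V v (c + 1) (d + 1) := by
    refine le_of_le_sup_smul hπ hfg fun x hx ↦ ?_
    obtain ⟨a, y, hy, rfl⟩ := hspanV hd hx
    obtain ⟨b, z, hz, rfl⟩ := h.exists_sum_add_V hc hy
    refine ⟨_, mem_boxSpan.2 ⟨a, fun i ↦ σ (b i), rfl⟩, z, hz, ?_⟩
    simp only [map_add, map_sum, h.F_smul, h.F_V, Function.iterate_succ_apply', add_assoc]
  -- the two independence statements, in the form in which they are used
  have hsumF {b : ℕ → R}
      (hb : ∃ y ∈ P, ∑ i ∈ range (c + 1), b i • F^[i + 1] v = π • y) :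
      ∀ i < c + 1, π ∣ b i := by
    obtain ⟨y, hy, hby⟩ := hb
    -- Since π y = F V y, one F can be cancelled, at the price of twisting the coefficients by σ⁻¹.
    have h1 : ∑ i ∈ range (c + 1), σ.symm (b i) • F^[i] v = V y := by
      apply hFinj
      simp only [map_sum, h.F_smul, σ.apply_symm_apply, h.F_V, ← hby,
        Function.iterate_succ_apply']
    intro i hi
    have h2 := dvd_of_sum_mem_map hπ h hc hcmin (b := fun i ↦ σ.symm (b i))
      ⟨y, hy, h1.symm⟩ i hi
    have h3 := map_dvd σ h2
    rwa [hσ, σ.apply_symm_apply] at h3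
  have hsumFmem (b : ℕ → R) : ∑ i ∈ range (c + 1), b i • F^[i + 1] v ∈ h.map P :=
    Submodule.sum_mem _ fun i _ ↦ Submodule.smul_mem _ _
      ⟨F^[i] v, hvP i, (Function.iterate_succ_apply' F i v).symm⟩
  have hdvdsum {n : ℕ} {a : ℕ → R} {f : ℕ → X} (hf : ∀ i, f i ∈ P) (ha : ∀ i < n, π ∣ a i) :
      ∃ y ∈ P, ∑ i ∈ range n, a i • f i = π • y := by
    choose! a' ha' using ha
    refine ⟨∑ i ∈ range n, a' i • f i, P.sum_mem fun i _ ↦ P.smul_mem _ (hf i), ?_⟩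
    rw [smul_sum]
    exact sum_congr rfl fun i hi ↦ by rw [ha' i (mem_range.1 hi), mul_smul]
  obtain ⟨a, b, hab⟩ := mem_boxSpan.1 (hle (hvP' (d + 1)))
  refine ⟨c, d, a, b, ?_, hab.symm, ?_⟩
  -- If b_c were divisible by π, then all a_j and b_i would be, so V^(d+1) v ∈ π P = V F P.
  -- Cancelling V gives V^d v ∈ FP, against minimality of d.
  · by_contra hbc
    have ha : ∀ j < d + 1, π ∣ a j := hSV hd hdmin (by
      rw [← sub_eq_of_eq_add hab.symm]
      exact Submodule.sub_mem _ hd (hsumFmem b))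
    obtain ⟨y, hy, hay⟩ := hdvdsum hvP' ha
    have hbc' : π ∣ b c := by
      by_contra h0
      exact hbc (isUnit_of_not_dvd hπ h0)
    obtain ⟨u, hu⟩ := hbc'
    have h1 : ∑ i ∈ range c, b i • F^[i + 1] v ∈ h.symm.map P := by
      refine ⟨V^[d] v - F y - F (u • F^[c + 1] v), P.sub_mem (P.sub_mem (hvP' d) (hPF _ hy))
        (hPF _ (P.smul_mem _ (hvP _))), ?_⟩
      rw [map_sub, map_sub, h.V_F, h.V_F, ← Function.iterate_succ_apply' (f := V), ← hab, hay,
        smul_smul, ← hu, sum_range_succ]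
      abel
    have hb : ∀ i < c + 1, π ∣ b i := by
      -- Shift the index: the coefficient of F^0 v is 0 and that of F^(i+1) v is b_i. With the i = c
      -- term dropped, all exponents are at most c, below the critical c+1.
      have h2 := dvd_of_sum_mem_map hπ h hc hcmin
        (b := fun i ↦ Nat.casesOn i 0 b) (by
          rw [sum_range_succ']
          simpa using h1)
      intro i hi
      rcases Nat.lt_succ_iff_lt_or_eq.1 hi with hi | rfl
      · exact h2 (i + 1) (by omega)
      · exact ⟨u, hu⟩
    obtain ⟨z, hz, hbz⟩ := hdvdsum (fun i ↦ hvP (i + 1)) hb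
    refine hdmin d (Nat.lt_succ_self d) ⟨y + z, P.add_mem hy hz, hVinj ?_⟩
    rw [h.V_F, smul_add, ← hay, ← hbz, hab, Function.iterate_succ_apply']
  · intro a' b' hab'
    -- Infinite descent: every coefficient of a relation is divisible by π, and dividing by π gives
    -- another relation because X is torsion-free.
    have key := eq_zero_of_forall_dvd hπ (s := {i | Sum.elim (· < d + 1) (· < c + 1) i})
      (P := fun f : ℕ ⊕ ℕ → R ↦ ∑ j ∈ range (d + 1), f (.inl j) • V^[j] v +
        ∑ i ∈ range (c + 1), f (.inr i) • F^[i + 1] v = 0) (fun f hf ↦ ?_)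
      (a := Sum.elim a' b') hab'
    · exact ⟨fun j hj ↦ key (.inl j) hj, fun i hi ↦ key (.inr i) hi⟩
    have ha : ∀ j < d + 1, π ∣ f (.inl j) := hSV hd hdmin (by
      rw [eq_neg_of_add_eq_zero_left hf]
      exact Submodule.neg_mem _ (hsumFmem _))
    obtain ⟨y, hy, hay⟩ := hdvdsum hvP' ha
    have hb : ∀ i < c + 1, π ∣ f (.inr i) := hsumF ⟨-y, P.neg_mem hy, by
      rw [eq_neg_of_add_eq_zero_right hf, hay, smul_neg]⟩
    choose! g hg using ha
    choose! g' hg' using hb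
    refine ⟨Sum.elim g g', htf _ ?_, ?_⟩
    · rw [← hf, smul_add, smul_sum, smul_sum]
      congr 1
      · exact sum_congr rfl fun i hi ↦ by
          rw [hg i (mem_range.1 hi), mul_smul, Sum.elim_inl]
      · exact sum_congr rfl fun i hi ↦ by
          rw [hg' i (mem_range.1 hi), mul_smul, Sum.elim_inr]
    · rintro (i | i) hi
      · exact hg i hi
      · exact hg' i hi

end Local

end FVPair

namespace DieudonneRing

open Dieudonne

/-! ### Generators and relations of the Dieudonné ring -/

section Structure

variable {p : ℕ} [Fact p.Prime] {R : Type*} [CommRing R]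

/-- The quotient map from the free algebra to the Dieudonné ring. -/
def mk : FreeAlgebra ℤ (Gen p R) →+* DieudonneRing p R := RingQuot.mkRingHom (Rel p R)

/-- The image of a generator in the Dieudonné ring. -/
def gen (g : Gen p R) : DieudonneRing p R :=
  mk (FreeAlgebra.ι ℤ g)

theorem mkRingHom_eq {x y : FreeAlgebra ℤ (Gen p R)} (h : Rel p R x y) :
    mk (p := p) (R := R) x = mk y :=
  RingQuot.mkRingHom_rel h

/-- The structure map from the Witt vectors to the Dieudonné ring. -/
def coeffHom : WittVector p R →+* DieudonneRing p R where
  toFun a := gen (.coeff a)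
  map_zero' := (mkRingHom_eq .coeff_zero).trans (map_zero mk)
  map_one' := (mkRingHom_eq .coeff_one).trans (map_one mk)
  map_add' a b := (mkRingHom_eq (.coeff_add a b)).trans
    (map_add mk _ _)
  map_mul' a b := (mkRingHom_eq (.coeff_mul a b)).trans
    (map_mul mk _ _)

theorem F_mul_V : (gen .F * gen .V : DieudonneRing p R) = (p : DieudonneRing p R) :=
  (map_mul mk _ _).symm.trans
    ((mkRingHom_eq .F_mul_V).trans (map_natCast mk p))

theorem V_mul_F : (gen .V * gen .F : DieudonneRing p R) = (p : DieudonneRing p R) :=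
  (map_mul mk _ _).symm.trans
    ((mkRingHom_eq .V_mul_F).trans (map_natCast mk p))

theorem F_mul_coeffHom (a : WittVector p R) :
    gen .F * coeffHom a = coeffHom (WittVector.frobenius a) * gen .F :=
  (map_mul mk _ _).symm.trans
    ((mkRingHom_eq (.F_mul_coeff a)).trans (map_mul mk _ _))

theorem coeffHom_mul_V (a : WittVector p R) :
    coeffHom a * gen .V = gen .V * coeffHom (WittVector.frobenius a) :=
  (map_mul mk _ _).symm.trans
    ((mkRingHom_eq (.coeff_mul_V a)).trans (map_mul mk _ _))

/-- An additive subgroup of the Dieudonné ring which contains `1` and is stable under left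
multiplication by the generators is everything. -/
theorem mem_of_gen_mul_mem (S : AddSubgroup (DieudonneRing p R)) (h1 : 1 ∈ S)
    (hS : ∀ g, ∀ x ∈ S, gen g * x ∈ S) (B : DieudonneRing p R) : B ∈ S := by
  have hmk : Function.Surjective (mk (p := p) (R := R)) := RingQuot.mkRingHom_surjective (Rel p R)
  obtain ⟨y, rfl⟩ := hmk B
  -- Strengthened to "left multiplication by y preserves S", which is compatible with products.
  suffices h : ∀ x ∈ S, mk y * x ∈ S by
    simpa using h 1 h1
  induction y using FreeAlgebra.induction with
  | grade0 r =>
    intro x hx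
    rw [eq_intCast (algebraMap ℤ (FreeAlgebra ℤ (Gen p R))) r, map_intCast, ← zsmul_eq_mul]
    exact S.zsmul_mem hx r
  | grade1 g => exact hS g
  | mul a b ha hb =>
    intro x hx
    have h2 := ha _ (hb x hx)
    rw [← mul_assoc] at h2
    rwa [map_mul]
  | add a b ha hb =>
    intro x hx
    have h2 := S.add_mem (ha x hx) (hb x hx)
    rw [← add_mul] at h2
    rwa [map_add]

/-- The Dieudonné ring as a left module over the Witt vectors. -/
abbrev wittModule : Module (WittVector p R) (DieudonneRing p R) :=
  Module.compHom _ coeffHom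

attribute [local instance] wittModule in
theorem smul_def (a : WittVector p R) (x : DieudonneRing p R) : a • x = coeffHom a * x := rfl

end Structure

/-! ### Principal annihilators in isocrystals -/

section Perfect

variable {p : ℕ} [Fact p.Prime] {K : Type*} [Field K] [CharP K p] [PerfectRing K p]

attribute [local instance] wittModule Dieudonne.wittModule

/-- Makes the box argument available inside 𝒟(K) itself, with e = 1. -/
theorem fvPair : FVPair (WittVector.frobeniusEquiv p K) (p : WittVector p K)
    (AddMonoidHom.mulLeft (gen .F : DieudonneRing p K)) (AddMonoidHom.mulLeft (gen .V)) where
  F_smul a x := by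
    simp only [AddMonoidHom.coe_mulLeft, smul_def, ← mul_assoc, F_mul_coeffHom]
    rfl
  V_smul a x := by
    have h := coeffHom_mul_V ((WittVector.frobeniusEquiv p K).symm a)
    have h2 : WittVector.frobenius ((WittVector.frobeniusEquiv p K).symm a) = a :=
      (WittVector.frobeniusEquiv p K).apply_symm_apply a
    rw [h2] at h
    simp only [AddMonoidHom.coe_mulLeft, smul_def, ← mul_assoc, h]
  F_V x := by
    simp only [AddMonoidHom.coe_mulLeft, smul_def, ← mul_assoc, F_mul_V, map_natCast]
  V_F x := by
    simp only [AddMonoidHom.coe_mulLeft, smul_def, ← mul_assoc, V_mul_F, map_natCast]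

variable {N : Type*} [AddCommGroup N] [WittVector.Isocrystal p K N]

theorem actionHom_mk (y : FreeAlgebra ℤ (Gen p K)) :
    actionHom p K N (mk y) = FreeAlgebra.lift ℤ (genAction p K N) y :=
  RingQuot.lift_mkRingHom_apply _ _ y

theorem gen_smul (g : Gen p K) (x : N) : (gen g : DieudonneRing p K) • x = genAction p K N g x := by
  change actionHom p K N (mk (FreeAlgebra.ι ℤ g)) x = _
  rw [actionHom_mk, FreeAlgebra.lift_ι_apply]

theorem F_smul (x : N) : (gen .F : DieudonneRing p K) • x = frob p K N x := gen_smul .F x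

theorem V_smul (x : N) : (gen .V : DieudonneRing p K) • x = ver p K N x := gen_smul .V x

theorem coeffHom_smul (a : WittVector p K) (x : N) : coeffHom a • x = a • x :=
  gen_smul (.coeff a) x

theorem fvPair_isocrystal : FVPair (WittVector.frobeniusEquiv p K) (p : WittVector p K)
    (frob p K N : N →+ N) (ver p K N) where
  F_smul a x := by
    change frob p K N (a • x) = WittVector.frobenius a • frob p K N x
    simp only [← coeffHom_smul, ← F_smul, ← mul_smul, F_mul_coeffHom]
  V_smul a x := by
    have h := fvPair.V_smul a (1 : DieudonneRing p K)
    simp only [AddMonoidHom.coe_mulLeft, smul_def, mul_one] at h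
    simp only [← coeffHom_smul, ← V_smul, ← mul_smul, h]
  F_V x := by
    change frob p K N (ver p K N x) = _
    simp only [← coeffHom_smul, ← V_smul, ← F_smul, ← mul_smul, F_mul_V, map_natCast]
  V_F x := by
    change ver p K N (frob p K N x) = _
    simp only [← coeffHom_smul, ← V_smul, ← F_smul, ← mul_smul, V_mul_F, map_natCast]

theorem isTorsionFree_isocrystal : Module.IsTorsionFree (WittVector p K) N :=
  Module.isTorsionFree_iff_smul_eq_zero.2 fun a x h ↦
    (smul_eq_zero.1 (show algebraMap (WittVector p K) K(p, K) a • x = 0 from h)).imp_left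
      fun h0 ↦ (IsFractionRing.injective (WittVector p K) K(p, K)) (h0.trans (map_zero _).symm)

/-- The annihilator of a nonzero element of an isocrystal which lies in a Dieudonné lattice on
which `F` and `V` are topologically nilpotent is principal. -/
theorem isPrincipal_torsionOf {v : N} (hv : v ≠ 0) {M : Submodule (WittVector p K) N}
    (hM : M.FG) (hvM : v ∈ M) (hMF : ∀ x ∈ M, frob p K N x ∈ M)
    (hMV : ∀ x ∈ M, ver p K N x ∈ M)
    (hF : ∃ n : ℕ, ∀ x ∈ M, ∃ y ∈ M, (frob p K N)^[n] x = p • y)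
    (hV : ∃ n : ℕ, ∀ x ∈ M, ∃ y ∈ M, (ver p K N)^[n] x = p • y) :
    (Ideal.torsionOf (DieudonneRing p K) N v).IsPrincipal := by
  have : Module.IsTorsionFree (WittVector p K) N := isTorsionFree_isocrystal
  have hN := fvPair_isocrystal (p := p) (K := K) (N := N)
  simp only [← Nat.cast_smul_eq_nsmul (WittVector p K)] at hF hV
  have hPM : FVPair.orbitSpan (WittVector p K) (frob p K N : N →+ N) (ver p K N) v ≤ M :=
    FVPair.orbitSpan_le hMF hMV hvM
  obtain ⟨c, d, a, b, hb, hab, hindep⟩ := FVPair.exists_relation (WittVector.irreducible p) hN hv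
    (Submodule.FG.of_le hM hPM)
    (hN.exists_iterate_eq_smul_of_le hM hPM (hN.F_mem_orbitSpan v) hF)
    (hN.symm.exists_iterate_eq_smul_of_le hM hPM (hN.V_mem_orbitSpan v) hV)
  set f : DieudonneRing p K →+ DieudonneRing p K := AddMonoidHom.mulLeft (gen .F) with hf
  set w : DieudonneRing p K →+ DieudonneRing p K := AddMonoidHom.mulLeft (gen .V) with hw
  have hfn (n : ℕ) : f^[n] 1 • v = (frob p K N : N →+ N)^[n] v := by
    induction n with
    | zero => exact one_smul _ v
    | succ n ih =>
      rw [Function.iterate_succ_apply', Function.iterate_succ_apply', ← ih, hf,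
        AddMonoidHom.coe_mulLeft, mul_smul, F_smul]
      rfl
  have hwn (n : ℕ) : w^[n] 1 • v = (ver p K N)^[n] v := by
    induction n with
    | zero => exact one_smul _ v
    | succ n ih =>
      rw [Function.iterate_succ_apply', Function.iterate_succ_apply', ← ih, hw,
        AddMonoidHom.coe_mulLeft, mul_smul, V_smul]
  have hbox (a b : ℕ → WittVector p K) :
      (∑ j ∈ range (d + 1), a j • w^[j] 1 + ∑ i ∈ range (c + 1), b i • f^[i + 1] 1) • v =
      ∑ j ∈ range (d + 1), a j • (ver p K N)^[j] v +
        ∑ i ∈ range (c + 1), b i • (frob p K N : N →+ N)^[i + 1] v := by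
    simp only [add_smul, sum_smul, smul_def, mul_smul, coeffHom_smul, hfn, hwn]
  set A : DieudonneRing p K := w^[d + 1] 1 -
    (∑ j ∈ range (d + 1), a j • w^[j] 1 + ∑ i ∈ range (c + 1), b i • f^[i + 1] 1) with hA
  have hAv : A • v = 0 := by
    rw [hA, sub_smul, hbox, hwn, hab, sub_self]
  have : IsScalarTower (WittVector p K) (DieudonneRing p K) (DieudonneRing p K) :=
    ⟨fun x y z ↦ mul_assoc _ _ _⟩
  set I : Ideal (DieudonneRing p K) := Ideal.span {A} with hI
  obtain ⟨hSF, hSV⟩ := fvPair.boxSpan_sup_stable (Q := I.restrictScalars (WittVector p K))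
    (fun x hx ↦ I.mul_mem_left _ hx) (fun x hx ↦ I.mul_mem_left _ hx) hb
    (Ideal.mem_span_singleton_self A)
  -- The box plus 𝒟(K)A contains 1 = V^0 and is stable under all generators, so it is the whole
  -- ring.
  have htop := mem_of_gen_mul_mem (FVPair.boxSpan (WittVector p K) f w 1 (c + 1) (d + 1) ⊔
    I.restrictScalars (WittVector p K)).toAddSubgroup
    (Submodule.mem_sup_left (FVPair.V_iterate_mem_boxSpan (Nat.succ_pos d)))
    (fun g ↦ match g with
      | .coeff a => fun x hx ↦ Submodule.smul_mem
          (FVPair.boxSpan (WittVector p K) f w 1 (c + 1) (d + 1) ⊔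
          I.restrictScalars (WittVector p K)) a hx
      | .F => hSF
      | .V => hSV)
  refine ⟨A, le_antisymm (fun B hB ↦ ?_) (Ideal.span_le.2 (Set.singleton_subset_iff.2 hAv))⟩
  -- Division by A: B = l + C with remainder l in the box and C ∈ 𝒟(K)A. Then B v = l v, and
  -- independence forces l = 0.
  obtain ⟨l, hl, C, hC, rfl⟩ := Submodule.mem_sup.1 (htop B)
  obtain ⟨a', b', rfl⟩ := FVPair.mem_boxSpan.1 hl
  have hCv : C • v = 0 := by
    obtain ⟨D, rfl⟩ := Ideal.mem_span_singleton'.1 (show C ∈ Ideal.span {A} from hC)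
    rw [mul_smul, hAv, smul_zero]
  rw [Ideal.mem_torsionOf_iff, add_smul, hCv, add_zero, hbox] at hB
  obtain ⟨ha', hb'⟩ := hindep a' b' hB
  rw [sum_eq_zero fun j hj ↦ by rw [ha' j (mem_range.1 hj), zero_smul],
    sum_eq_zero fun i hi ↦ by rw [hb' i (mem_range.1 hi), zero_smul], add_zero, zero_add]
  exact hC

/-- Integers are central in 𝒟(K), so B (n v) = n (B v), and N is torsion-free. -/
theorem torsionOf_natCast_smul (n : ℕ) (hn : (n : WittVector p K) ≠ 0) (v : N) :
    Ideal.torsionOf (DieudonneRing p K) N ((n : WittVector p K) • v) =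
      Ideal.torsionOf (DieudonneRing p K) N v := by
  have : Module.IsTorsionFree (WittVector p K) N := isTorsionFree_isocrystal
  ext B
  rw [Ideal.mem_torsionOf_iff, Ideal.mem_torsionOf_iff, Nat.cast_smul_eq_nsmul, smul_comm,
    ← Nat.cast_smul_eq_nsmul (WittVector p K), smul_eq_zero, or_iff_right hn]

end Perfect

end DieudonneRing

namespace Dieudonne

/-! ### Base change of Dieudonné lattices -/

section Lattice

open scoped Pointwise

variable {p : ℕ} [Fact p.Prime]
  {k : Type*} [Field k] [CharP k p] [PerfectRing k p]
  {K : Type*} [Field K] [CharP K p] [PerfectRing K p] [Algebra k K]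
  {N : Type*} [AddCommGroup N] [WittVector.Isocrystal p k N]

attribute [local instance] wittModule fracAlgebra

variable (K) in
/-- The map `x ↦ 1 ⊗ x` from an isocrystal to its base change. -/
def toBaseChange : N →+ BaseChange p k K N where
  toFun x := (1 : K(p, K)) ⊗ₜ[K(p, k)] x
  map_zero' := TensorProduct.tmul_zero _ _
  map_add' := TensorProduct.tmul_add _

omit [PerfectRing K p] in
theorem smul_toBaseChange (c : K(p, K)) (x : N) :
    c • toBaseChange (p := p) (k := k) K x = c ⊗ₜ[K(p, k)] x :=
  (TensorProduct.smul_tmul' c 1 x).trans (by rw [smul_eq_mul, mul_one])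

omit [PerfectRing K p] in
theorem toBaseChange_smul_frac (a : K(p, k)) (x : N) :
    toBaseChange (p := p) (k := k) K (a • x) = fracMap p k K a • toBaseChange K x := by
  rw [smul_toBaseChange]
  refine (TensorProduct.smul_tmul a (1 : K(p, K)) x).symm.trans ?_
  rw [Algebra.smul_def, mul_one, RingHom.algebraMap_toAlgebra]

omit [CharP k p] [PerfectRing k p] [PerfectRing K p] in
theorem fracMap_algebraMap (a : WittVector p k) : fracMap p k K (algebraMap _ _ a) =
    algebraMap _ _ (WittVector.map (algebraMap k K) a) := by
  simp [fracMap, IsFractionRing.map]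

theorem toBaseChange_smul (a : WittVector p k) (x : N) :
    toBaseChange (p := p) (k := k) K (a • x) =
      WittVector.map (algebraMap k K) a • toBaseChange (p := p) (k := k) K x := by
  refine (toBaseChange_smul_frac (algebraMap (WittVector p k) K(p, k) a) x).trans ?_
  rw [fracMap_algebraMap]
  rfl

theorem frob_toBaseChange (x : N) : frob p K (BaseChange p k K N) (toBaseChange K x) =
    toBaseChange K (frob p k N x) := by
  refine (frob_baseChange_tmul p k K N 1 x).trans ?_
  rw [map_one]
  rfl

/-- It suffices to compare after the injective F, where both sides become p times the image of x. -/
theorem ver_toBaseChange (x : N) : ver p K (BaseChange p k K N) (toBaseChange K x) =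
    toBaseChange K (ver p k N x) := by
  apply (frob p K (BaseChange p k K N)).injective
  refine (DieudonneRing.fvPair_isocrystal.F_V _).trans (Eq.trans ?_ (frob_toBaseChange _).symm)
  refine Eq.trans ?_ (congrArg (toBaseChange K) (DieudonneRing.fvPair_isocrystal.F_V x).symm)
  rw [toBaseChange_smul, map_natCast]

variable (K) in
/-- The `W(K)`-lattice in the base change generated by a `W(k)`-submodule. -/
def baseChangeLattice (M : Submodule (WittVector p k) N) :
    Submodule (WittVector p K) (BaseChange p k K N) :=
  Submodule.span _ (toBaseChange K '' (M : Set N))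

theorem toBaseChange_mem {M : Submodule (WittVector p k) N} {x : N} (hx : x ∈ M) :
    toBaseChange K x ∈ baseChangeLattice K M :=
  Submodule.subset_span ⟨x, hx, rfl⟩

theorem baseChangeLattice_fg {M : Submodule (WittVector p k) N} (hM : M.FG) :
    (baseChangeLattice K M).FG := by
  classical
  obtain ⟨s, rfl⟩ := hM
  refine ⟨s.image (toBaseChange K), le_antisymm ?_ (Submodule.span_le.2 ?_)⟩
  · rw [coe_image]
    exact Submodule.span_mono (Set.image_mono Submodule.subset_span)
  · rintro _ ⟨x, hx, rfl⟩
    induction hx using Submodule.span_induction with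
    | mem x hx => exact Submodule.subset_span (by simpa using ⟨x, hx, rfl⟩)
    | zero => rw [map_zero]; exact Submodule.zero_mem _
    | add x y _ _ hx hy => rw [map_add]; exact Submodule.add_mem _ hx hy
    | smul a x _ hx => rw [toBaseChange_smul]; exact Submodule.smul_mem _ _ hx

/-- The preimage of the lattice under the semilinear F is a submodule, so generators suffice. A
general pair covers both Frobenius and Verschiebung. -/
theorem apply_mem_of_generators {M : Submodule (WittVector p k) N}
    {σ : WittVector p K ≃+* WittVector p K} {π : WittVector p K}
    {F V : BaseChange p k K N →+ BaseChange p k K N} (h : FVPair σ π F V) {G : N → N}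
    (hG : ∀ x, F (toBaseChange K x) = toBaseChange K (G x)) (hM : ∀ x ∈ M, G x ∈ M) :
    ∀ x ∈ baseChangeLattice K M, F x ∈ baseChangeLattice K M := by
  change baseChangeLattice K M ≤ h.comap (baseChangeLattice K M)
  refine Submodule.span_le.2 ?_
  rintro _ ⟨x, hx, rfl⟩
  rw [SetLike.mem_coe, FVPair.mem_comap, hG]
  exact toBaseChange_mem (hM x hx)

theorem exists_iterate_eq_of_generators {M : Submodule (WittVector p k) N}
    {σ : WittVector p K ≃+* WittVector p K} {π : WittVector p K}
    {F V : BaseChange p k K N →+ BaseChange p k K N} (h : FVPair σ π F V) {G : N → N}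
    (hG : ∀ x, F (toBaseChange K x) = toBaseChange K (G x)) {n : ℕ}
    (hn : ∀ x ∈ M, ∃ y ∈ M, G^[n] x = p • y) :
    ∀ x ∈ baseChangeLattice K M, ∃ y ∈ baseChangeLattice K M, F^[n] x = p • y := by
  have hle : baseChangeLattice K M ≤
      h.comap^[n] ((p : WittVector p K) • baseChangeLattice K M) := by
    refine Submodule.span_le.2 ?_
    rintro _ ⟨x, hx, rfl⟩
    obtain ⟨y, hy, hxy⟩ := hn x hx
    rw [SetLike.mem_coe, FVPair.mem_iterate_comap, Submodule.mem_smul_pointwise_iff_exists]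
    refine ⟨toBaseChange K y, toBaseChange_mem hy, ?_⟩
    rw [Nat.cast_smul_eq_nsmul, ← map_nsmul, ← hxy]
    exact ((show Function.Semiconj (toBaseChange K) G F from
      fun x ↦ (hG x).symm).iterate_right n).eq x
  intro x hx
  obtain ⟨y, hy, hyx⟩ := (Submodule.mem_smul_pointwise_iff_exists _ _ _).1
    ((h.mem_iterate_comap n).1 (hle hx))
  exact ⟨y, hy, by rw [← hyx, Nat.cast_smul_eq_nsmul]⟩

/-- Every denominator is a unit times a power of p. -/
theorem exists_pow_smul_eq_algebraMap (c : K(p, K)) :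
    ∃ (n : ℕ) (a : WittVector p K), (p : K(p, K)) ^ n * c = algebraMap _ _ a := by
  obtain ⟨a, b, hb, rfl⟩ := IsFractionRing.div_surjective (A := WittVector p K) c
  obtain ⟨n, u, rfl⟩ := IsDiscreteValuationRing.eq_unit_mul_pow_irreducible
    (nonZeroDivisors.ne_zero hb) (WittVector.irreducible p)
  refine ⟨n, a * ↑u⁻¹, ?_⟩
  have hb0 : algebraMap (WittVector p K) K(p, K) (u * (p : WittVector p K) ^ n) ≠ 0 :=
    IsFractionRing.to_map_ne_zero_of_mem_nonZeroDivisors hb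
  rw [mul_div_assoc', div_eq_iff hb0, ← map_mul, ← map_natCast (algebraMap (WittVector p K) _),
    ← map_pow, ← map_mul]
  congr 1
  rw [mul_assoc, ← mul_assoc (↑u⁻¹ : WittVector p K), Units.inv_mul, one_mul, mul_comm]

theorem exists_pow_smul_mem_baseChangeLattice {M : Submodule (WittVector p k) N}
    (hM : Submodule.span K(p, k) (M : Set N) = ⊤) (v : BaseChange p k K N) :
    ∃ n : ℕ, (p : WittVector p K) ^ n • v ∈ baseChangeLattice K M := by
  have hadd {x y : BaseChange p k K N}
      (hx : ∃ n : ℕ, (p : WittVector p K) ^ n • x ∈ baseChangeLattice K M)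
      (hy : ∃ n : ℕ, (p : WittVector p K) ^ n • y ∈ baseChangeLattice K M) :
      ∃ n : ℕ, (p : WittVector p K) ^ n • (x + y) ∈ baseChangeLattice K M := by
    obtain ⟨m, hm⟩ := hx
    obtain ⟨n, hn⟩ := hy
    refine ⟨m + n, ?_⟩
    rw [smul_add]
    refine Submodule.add_mem _ ?_ ?_
    · rw [pow_add, mul_comm, mul_smul]
      exact Submodule.smul_mem _ _ hm
    · rw [pow_add, mul_smul]
      exact Submodule.smul_mem _ _ hn
  -- The scalar c is quantified inside the induction on x, so that scalars from Quot(W(k)) can be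
  -- absorbed into it.
  have hgen (x : N) : ∀ c : K(p, K), ∃ n : ℕ,
      (p : WittVector p K) ^ n • c • toBaseChange (p := p) (k := k) K x ∈
        baseChangeLattice K M := by
    have hx : x ∈ Submodule.span K(p, k) (M : Set N) := hM ▸ Submodule.mem_top
    induction hx using Submodule.span_induction with
    | mem x hx =>
      intro c
      obtain ⟨n, a, ha⟩ := exists_pow_smul_eq_algebraMap c
      refine ⟨n, ?_⟩
      have h1 : (p : WittVector p K) ^ n • c • toBaseChange (p := p) (k := k) K x =
          a • toBaseChange (p := p) (k := k) K x := by
        change algebraMap (WittVector p K) K(p, K) ((p : WittVector p K) ^ n) • c • _ =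
          algebraMap (WittVector p K) K(p, K) a • toBaseChange (p := p) (k := k) K x
        rw [← ha, mul_smul, map_pow, map_natCast]
      rw [h1]
      exact Submodule.smul_mem _ _ (toBaseChange_mem hx)
    | zero => exact fun c ↦ ⟨0, by simp⟩
    | add x y _ _ hx hy =>
      intro c
      rw [map_add, smul_add]
      exact hadd (hx c) (hy c)
    | smul a x _ hx =>
      intro c
      rw [toBaseChange_smul_frac, smul_smul]
      exact hx _
  change K(p, K) ⊗[K(p, k)] N at v
  induction v using TensorProduct.induction_on with
  | zero => exact ⟨0, Submodule.smul_mem _ _ (Submodule.zero_mem (baseChangeLattice K M))⟩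
  | tmul c x => exact smul_toBaseChange (p := p) (k := k) c x ▸ hgen x c
  | add x y hx hy => exact hadd hx hy

/-- Annihilators of nonzero elements in base changes of bi-infinitesimal isocrystals are
principal. -/
theorem IsBiInfinitesimal.isPrincipal_torsionOf (hN : IsBiInfinitesimal p k N)
    {v : BaseChange p k K N} (hv : v ≠ 0) :
    (Ideal.torsionOf (DieudonneRing p K) (BaseChange p k K N) v).IsPrincipal := by
  obtain ⟨M, hM, ⟨m, hm⟩, ⟨n, hn⟩⟩ := hN
  obtain ⟨r, hr⟩ := exists_pow_smul_mem_baseChangeLattice (K := K) hM.span_eq_top v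
  have hpr : ((p ^ r : ℕ) : WittVector p K) ≠ 0 := by
    rw [Nat.cast_pow]
    exact pow_ne_zero r (WittVector.irreducible p).ne_zero
  have : Module.IsTorsionFree (WittVector p K) (BaseChange p k K N) :=
    DieudonneRing.isTorsionFree_isocrystal
  have h := DieudonneRing.fvPair_isocrystal (p := p) (K := K) (N := BaseChange p k K N)
  rw [← DieudonneRing.torsionOf_natCast_smul (p ^ r) hpr]
  rw [← Nat.cast_pow] at hr
  exact DieudonneRing.isPrincipal_torsionOf (smul_ne_zero hpr hv) (baseChangeLattice_fg hM.fg) hr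
    (apply_mem_of_generators h frob_toBaseChange hM.frob_mem)
    (apply_mem_of_generators h.symm ver_toBaseChange hM.ver_mem)
    ⟨m, exists_iterate_eq_of_generators h frob_toBaseChange hm⟩
    ⟨n, exists_iterate_eq_of_generators h.symm ver_toBaseChange hn⟩

end Lattice

end Dieudonne

end

theorem mainTheorem8 (p : ℕ) [Fact p.Prime]
    (k : Type*) [Field k] [IsAlgClosed k] [CharP k p]
    (K : Type*) [Field K] [CharP K p] [PerfectRing K p] [Algebra k K]
    (N : Type*) [AddCommGroup N] [WittVector.Isocrystal p k N]
    [Module.Finite (FractionRing (WittVector p k)) N]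
    (hsimple : Dieudonne.IsSimpleIsocrystal p k N)
    (hbi : Dieudonne.IsBiInfinitesimal p k N)
    (v : Dieudonne.BaseChange p k K N) (hv : v ≠ 0) :
    (Ideal.torsionOf (DieudonneRing p K) (Dieudonne.BaseChange p k K N) v).IsPrincipal :=
  hbi.isPrincipal_torsionOf hv
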